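/- Let $\lambda,v,c>0$ and $T>0$. A project has two stages. The waiting time for the first stage and the further waiting time for the second stage are independent and exponentially distributed with parameter $\lambda$; $\tau_2$ is the completion date of the second stage and $x_t\in\{0,1,2\}$ is the number of stages completed by date $t$. A principal pays the flow cost $c$ until he (irreversibly) stops at a date $\tau\in[0,T]$, and he receives $v$ if and only if $x_\tau=2$. His payoff is $V(\tau)=P(x_\tau=2)\,v-E[\tau]\,c$, and the agent's payoff is $W(\tau)=E[\tau]\,c$. The principal does not observe $x$ but only messages. An information policy is a rule by which the agent sends messages that may be random and may depend on past and current states and past messages, but not on the future of $x$. An investment schedule is a $[0,T]$-valued stopping time $\tau$ of the natural filtration of $x$. Its recommendation mechanism sends at date $t$ the message "continue" if $t<\tau$ and "stop" if $t\ge\tau$. The principal's continuation value is $$V_t(\tau)=\bigl[P(x_\tau=2\mid t<\tau)-P(x_t=2\mid t<\tau)\bigr]v-E[\tau-t\mid t<\tau]\,c ,$$ and the agent's problem is to maximize $c\,E[\tau]$ over all investment schedules with $V_t(\tau)\ge 0$ for all $t\ge 0$ with $P(t<\tau)>0$. Let $V^{NI}=\max_{s\in[0,T]}V(s)$ (over deterministic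 dates $s$) be the principal's no-information payoff. Put $$\kappa=\frac{c}{v\lambda},\qquad \kappa^{ND}=e^{-\lambda T}\lambda T,\qquad \tilde\kappa=\frac{1-e^{\lambda T}+\lambda T}{2-2e^{\lambda T}+\lambda T}.$$ **Proposition.** Assume $e^{\lambda T}>\lambda T(\lambda T+1)+1$ and $\kappa^{ND}<\kappa\le\tilde\kappa$. Then there is a deterministic date $S^*\in[0,T)$, depending only on $\lambda,v,c,T$, such that $$\tau=S^*\vee(\tau_2\wedge T)$$ is an investment schedule with the following properties. 1. Its mechanism gives no recommendation to stop before $S^*$. At $S^*$ it recommends stopping if the second stage is already complete; otherwise it recommends stopping at the moment $\tau_2$ at which the second stage is completed (for $S^*\le t<T$ the message at $t$ is "stop" if and only if $x_t=2$). 2. $V(\tau)=V^{NI}$, and the individual rationality constraint binds at the no-information stopping date: $V_s(\tau)=0$ for every $s\in[0,T]$ with $V(s)=V^{NI}$. 3. $\tau$ solves the agent's problem; in particular $V_t(\tau)\ge 0$ at every date $t$ with $P(t<\tau)>0$. 4. The mechanism is obedient at every date: whenever continuing is recommended at $t$, almost surely no stopping plan from $t$ on based on the recommendations has a higher conditional expected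 payoff for the principal than following them; and once stopping is recommended, any plan that continues beyond $\tau$ with positive probability is strictly worse for him. 5. The mechanism is optimal: $\tau$ is a best reply of the principal to it, and for every information policy and every best reply $\rho$ of the principal to it, $c\,E[\rho]\le c\,E[\tau]$. -/

import Mathlib

open MeasureTheory ProbabilityTheory
open scoped NNReal ENNReal

noncomputable section

namespace TwoStage

/-- The filtration generated by a process `y` indexed by the dates `t ≥ 0`: the information
available at date `t` is the one carried by the values `y s`, `s ≤ t`. -/
def historyFiltration {Ω M : Type*} [mΩ : MeasurableSpace Ω] [mM : MeasurableSpace M]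
    (y : ℝ≥0 → Ω → M) (hy : ∀ t, Measurable (y t)) : Filtration ℝ≥0 mΩ where
  seq t := ⨆ s ≤ t, mM.comap (y s)
  mono' := fun _ _ h => iSup₂_mono' fun s hs => ⟨s, hs.trans h, le_rfl⟩
  le' := fun _ => iSup₂_le fun s _ => (hy s).comap_le

/-- A project with two stages, each of which is completed at Poisson rate `lam`: the waiting time
for the first stage and the further waiting time for the second stage are independent and
exponentially distributed with parameter `lam`. -/
structure Project {Ω : Type*} [MeasurableSpace Ω] (P : Measure Ω) (lam : ℝ) where
  /-- waiting time until the first stage is completed -/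
  wait₁ : Ω → ℝ≥0
  /-- further waiting time until the second stage is completed -/
  wait₂ : Ω → ℝ≥0
  measurable_wait₁ : Measurable wait₁
  measurable_wait₂ : Measurable wait₂
  law_wait₁ : P.map (fun ω => (wait₁ ω : ℝ)) = expMeasure lam
  law_wait₂ : P.map (fun ω => (wait₂ ω : ℝ)) = expMeasure lam
  indep : IndepFun wait₁ wait₂ P

variable {Ω : Type*} [mΩ : MeasurableSpace Ω] {P : Measure Ω} {lam : ℝ}

namespace Project

/-- The date `τ₂` at which the second stage is completed. -/
def completion₂ (X : Project P lam) (ω : Ω) : ℝ≥0 := X.wait₁ ω + X.wait₂ ω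

/-- The state `x_t`: the number of stages completed by date `t`. -/
def state (X : Project P lam) (t : ℝ≥0) (ω : Ω) : ℕ :=
  if X.completion₂ ω ≤ t then 2 else if X.wait₁ ω ≤ t then 1 else 0

theorem measurable_state (X : Project P lam) (t : ℝ≥0) : Measurable (X.state t) :=
  Measurable.ite
    (measurableSet_le (X.measurable_wait₁.add X.measurable_wait₂) measurable_const)
    measurable_const
    (Measurable.ite (measurableSet_le X.measurable_wait₁ measurable_const)
      measurable_const measurable_const)

/-- The natural filtration of the state process. -/
def filtration (X : Project P lam) : Filtration ℝ≥0 mΩ :=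
  historyFiltration X.state X.measurable_state

/-- Realized payoff of the principal when he stops at the random date `ρ`: he receives `v` if the
second stage is completed by then, and pays the flow cost `c` until `ρ`. -/
def realizedPayoff (X : Project P lam) (v c : ℝ) (ρ : Ω → ℝ≥0) (ω : Ω) : ℝ :=
  (if X.state (ρ ω) ω = 2 then v else 0) - c * (ρ ω : ℝ)

/-- The principal's expected payoff `V(ρ) = P(x_ρ = 2) v - E[ρ] c`. -/
def principalPayoff (X : Project P lam) (v c : ℝ) (ρ : Ω → ℝ≥0) : ℝ :=
  P.real {ω | X.state (ρ ω) ω = 2} * v - (∫ ω, (ρ ω : ℝ) ∂P) * c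

/-- The agent's expected payoff `W(ρ) = E[ρ] c`. -/
def agentPayoff (_X : Project P lam) (c : ℝ) (ρ : Ω → ℝ≥0) : ℝ :=
  (∫ ω, (ρ ω : ℝ) ∂P) * c

/-- The principal's continuation value at date `t`, given that `t < ρ`:
`V_t(ρ) = [P(x_ρ = 2 | t < ρ) - P(x_t = 2 | t < ρ)] v - E[ρ - t | t < ρ] c`. -/
def continuationValue (X : Project P lam) (v c : ℝ) (ρ : Ω → ℝ≥0) (t : ℝ≥0) : ℝ :=
  ((cond P {ω | t < ρ ω}).real {ω | X.state (ρ ω) ω = 2}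
      - (cond P {ω | t < ρ ω}).real {ω | X.state t ω = 2}) * v
    - (∫ ω, ((ρ ω : ℝ) - (t : ℝ)) ∂(cond P {ω | t < ρ ω})) * c

/-- The principal's payoff `V^NI` in the no-information benchmark: the best payoff that he can
get by choosing a deterministic stopping date in `[0, T]`. -/
def noInfoValue (X : Project P lam) (v c : ℝ) (T : ℝ≥0) : ℝ :=
  sSup ((fun s : ℝ≥0 => X.principalPayoff v c (fun _ => s)) '' Set.Iic T)

end Project

/-- An investment schedule: a `[0, T]`-valued stopping time of the natural filtration of the
state process. -/
structure InvestmentSchedule (X : Project P lam) (T : ℝ≥0) where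
  time : Ω → ℝ≥0
  le_deadline : ∀ ω, time ω ≤ T
  isStoppingTime : IsStoppingTime X.filtration (fun ω => (time ω : WithTop ℝ≥0))

/-- An information policy with message space `M`: the message sent at date `t` may be random, and
its distribution may depend on the history of states and messages up to `t`, but not on the future
of the state process: given the states up to `t`, the messages sent up to `t` are independent of
the whole path of the state process. -/
structure InformationPolicy (X : Project P lam) (M : Type*) [MeasurableSpace M] where
  message : ℝ≥0 → Ω → M
  measurable_message : ∀ t, Measurable (message t)
  nonanticipating : ∀ (t : ℝ≥0) (A : Set Ω),
    MeasurableSet[historyFiltration message measurable_message t] A →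
      P[A.indicator (fun _ => (1 : ℝ)) | ⨆ s, X.filtration s]
        =ᵐ[P] P[A.indicator (fun _ => (1 : ℝ)) | X.filtration t]

/-- What the principal knows under an information policy: the messages received so far. -/
def InformationPolicy.filtration {X : Project P lam} {M : Type*} [MeasurableSpace M]
    (σ : InformationPolicy X M) : Filtration ℝ≥0 mΩ :=
  historyFiltration σ.message σ.measurable_message

/-- A strategy of the principal under the policy `σ`: a stopping date in `[0, T]`, where the
decision to stop by `t` is based on the messages received by `t`. -/
structure IsStrategy {X : Project P lam} {M : Type*} [MeasurableSpace M]
    (σ : InformationPolicy X M) (T : ℝ≥0) (ρ : Ω → ℝ≥0) : Prop where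
  le_deadline : ∀ ω, ρ ω ≤ T
  isStoppingTime : IsStoppingTime σ.filtration (fun ω => (ρ ω : WithTop ℝ≥0))

/-- `ρ` is a best reply of the principal to the information policy `σ`. -/
structure IsBestReply {X : Project P lam} {M : Type*} [MeasurableSpace M]
    (σ : InformationPolicy X M) (v c : ℝ) (T : ℝ≥0) (ρ : Ω → ℝ≥0) : Prop where
  isStrategy : IsStrategy σ T ρ
  optimal : ∀ ρ', IsStrategy σ T ρ' → X.principalPayoff v c ρ' ≤ X.principalPayoff v c ρ

namespace InvestmentSchedule

variable {X : Project P lam} {T : ℝ≥0}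

/-- The recommendation at date `t`: `1` (continue) as long as `t < τ`, and `0` (stop) from `τ` on. -/
def recommendation (τ : InvestmentSchedule X T) (t : ℝ≥0) (ω : Ω) : Fin 2 :=
  if t < τ.time ω then 1 else 0

theorem recommendation_adapted (τ : InvestmentSchedule X T) (t : ℝ≥0) :
    Measurable[X.filtration t] (τ.recommendation t) := by
  have h : MeasurableSet[X.filtration t] {ω | t < τ.time ω} := by
    have h' := (τ.isStoppingTime t).compl
    convert h' using 1
    ext ω
    simp only [Set.mem_ofPred_eq, Set.mem_compl_iff, WithTop.coe_le_coe, not_le]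
  unfold recommendation
  exact Measurable.ite h measurable_const measurable_const

theorem recommendation_measurable (τ : InvestmentSchedule X T) (t : ℝ≥0) :
    Measurable (τ.recommendation t) :=
  (τ.recommendation_adapted t).mono (X.filtration.le t) le_rfl

theorem recommendation_history_le (τ : InvestmentSchedule X T) (t : ℝ≥0) :
    historyFiltration τ.recommendation τ.recommendation_measurable t ≤ X.filtration t :=
  iSup₂_le fun s hs => (τ.recommendation_adapted s).comap_le.trans (X.filtration.mono hs)

/-- The direct recommendation mechanism that implements the investment schedule `τ`. -/
def mechanism [IsProbabilityMeasure P] (τ : InvestmentSchedule X T) :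
    InformationPolicy X (Fin 2) where
  message := τ.recommendation
  measurable_message := τ.recommendation_measurable
  nonanticipating := by
    intro t A hA
    have hA' : MeasurableSet[X.filtration t] A := τ.recommendation_history_le t A hA
    have hle : (⨆ s, X.filtration s) ≤ mΩ := iSup_le fun s => X.filtration.le s
    have hA'' : MeasurableSet[⨆ s, X.filtration s] A :=
      le_iSup (fun s => (X.filtration s : MeasurableSpace Ω)) t A hA'
    have hint : Integrable (A.indicator (fun _ => (1 : ℝ))) P :=
      (integrable_const (1 : ℝ)).indicator (X.filtration.le t A hA')
    rw [condExp_of_stronglyMeasurable hle (stronglyMeasurable_const.indicator hA'') hint,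
      condExp_of_stronglyMeasurable (X.filtration.le t)
        (stronglyMeasurable_const.indicator hA') hint]

/-- The system of individual rationality constraints: `V_t(τ) ≥ 0` for every date `t ≥ 0` that
is reached before stopping with positive probability. -/
def IsIndividuallyRational (τ : InvestmentSchedule X T) (v c : ℝ) : Prop :=
  ∀ t : ℝ≥0, P {ω | t < τ.time ω} ≠ 0 → 0 ≤ X.continuationValue v c τ.time t

/-- `τ` solves the agent's problem: it maximizes `c E[τ]` over all investment schedules that
satisfy the individual rationality constraints. -/
structure SolvesAgentProblem (τ : InvestmentSchedule X T) (v c : ℝ) : Prop where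
  feasible : τ.IsIndividuallyRational v c
  optimal : ∀ τ' : InvestmentSchedule X T, τ'.IsIndividuallyRational v c →
    X.agentPayoff c τ'.time ≤ X.agentPayoff c τ.time

/-- Obedience at every date, for a principal who observes the recommendations.
If continuing is recommended at date `t`, then no plan for the dates from `t` on that he could
follow, stopping at once included, has a higher conditional expected payoff than following the
recommendations. If stopping is recommended, then every plan that lets him invest beyond the
recommended date with positive probability is strictly worse. -/
structure IsObedient [IsProbabilityMeasure P] (τ : InvestmentSchedule X T) (v c : ℝ) : Prop where
  continue_optimal : ∀ (t : ℝ≥0) (ρ : Ω → ℝ≥0), IsStrategy τ.mechanism T ρ → (∀ ω, t ≤ ρ ω) →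
    ∀ᵐ ω ∂P, t < τ.time ω →
      (P[X.realizedPayoff v c ρ | τ.mechanism.filtration t]) ω
        ≤ (P[X.realizedPayoff v c τ.time | τ.mechanism.filtration t]) ω
  stop_optimal : ∀ ρ : Ω → ℝ≥0, IsStrategy τ.mechanism T ρ → (∀ ω, τ.time ω ≤ ρ ω) →
    P {ω | τ.time ω < ρ ω} ≠ 0 →
      X.principalPayoff v c ρ < X.principalPayoff v c τ.time

end InvestmentSchedule

/-- The cutoff `κ^ND(T, λ) = e^{-λT} λT`. -/
def kappaND (T : ℝ≥0) (lam : ℝ) : ℝ := Real.exp (-(lam * T)) * (lam * T)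

/-- The cutoff `κ̃(T, λ) = (1 - e^{λT} + λT) / (2 - 2 e^{λT} + λT)`. -/
def kappaTilde (T : ℝ≥0) (lam : ℝ) : ℝ :=
  (1 - Real.exp (lam * T) + lam * T) / (2 - 2 * Real.exp (lam * T) + lam * T)

end TwoStage

end

namespace TwoStage

/-! Write p(t) = P(τ₂ ≤ t), G(t) = E[τ₂ ∧ t], V(s) = p(s)v - sc, F(t) = p(t)v - G(t)c, and D(s,t) =
F(t) - (s - G(s))c for the payoff of s ∨ (τ₂ ∧ t).

Upper bound. The agent's payoff is the surplus P(x_ρ = 2)v minus the principal's payoff. The first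
term is at most p(T)v. Under any information policy the principal can still choose a deterministic
date, so a best reply gives him at least V^NI. Hence the agent gets at most p(T)v - V^NI. In the
agent's problem the constraint at a maximizer m of V alone gives the same bound (`agentPayoff_le`).
A schedule S ∨ (τ₂ ∧ T) attains it when D(S,T) = V^NI: it loses no success possible by T and leaves
the principal exactly V^NI.

Existence of S (`exists_disclosure_date`). D(·,T) is continuous. At T it equals V(T), which is below
V^NI because κ > κ^ND makes V decrease at T. At m it is at least V^NI: F first falls and then rises,
and the first-order condition puts an interior m on the rising branch; if m = 0, the claim is F(T) ≥
0, which is κ ≤ κ̃. The intermediate value theorem gives S in [m, T).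

Obedience. While "continue" is sent the messages are constant, so a deviation before τ amounts to a
deterministic date r (`exists_min_eq_min`), and investing beyond τ is pure cost. Stopping at r ∧ τ
yields V(r) for r ≤ S and D(S,r) for r ≥ S; the shape of F bounds the latter by max(V(S), D(S,T)).
Neither exceeds V^NI. -/

/-! ### Calculus of completion probabilities and payoffs -/

/-- The probability that the second stage is completed by date `t`. -/
noncomputable def completionProb (lam t : ℝ) : ℝ := 1 - (1 + lam * t) * Real.exp (-(lam * t))

/-- The expected value of the completion date of the second stage truncated at `t`. -/
noncomputable def truncatedMean (lam t : ℝ) : ℝ := (2 - (2 + lam * t) * Real.exp (-(lam * t))) / lam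

theorem hasDerivAt_exp_neg_mul (lam t : ℝ) :
    HasDerivAt (fun x => Real.exp (-(lam * x))) (-lam * Real.exp (-(lam * t))) t := by
  have h : HasDerivAt (fun x => Real.exp (-(lam * x))) (Real.exp (-(lam * t)) * -(lam * 1)) t :=
    ((hasDerivAt_id t).const_mul lam).neg.exp
  convert! h using 1
  ring

theorem hasDerivAt_completionProb (lam t : ℝ) :
    HasDerivAt (completionProb lam) (lam ^ 2 * t * Real.exp (-(lam * t))) t := by
  have h1 : HasDerivAt (fun x => 1 + lam * x) lam t := by
    simpa using ((hasDerivAt_id t).const_mul lam).const_add 1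
  have h := (h1.mul (hasDerivAt_exp_neg_mul lam t)).const_sub 1
  convert! h using 1
  ring

theorem hasDerivAt_truncatedMean {lam : ℝ} (hlam : 0 < lam) (t : ℝ) :
    HasDerivAt (truncatedMean lam) (1 - completionProb lam t) t := by
  have h1 : HasDerivAt (fun x => 2 + lam * x) lam t := by
    simpa using ((hasDerivAt_id t).const_mul lam).const_add 2
  have h := ((h1.mul (hasDerivAt_exp_neg_mul lam t)).const_sub 2).div_const lam
  convert! h using 1
  unfold completionProb
  field_simp
  ring

@[simp] theorem completionProb_zero (lam : ℝ) : completionProb lam 0 = 0 := by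
  simp [completionProb]

@[simp] theorem truncatedMean_zero (lam : ℝ) : truncatedMean lam 0 = 0 := by
  simp [truncatedMean]

theorem completionProb_pos {lam t : ℝ} (hlam : 0 < lam) (ht : 0 < t) :
    0 < completionProb lam t := by
  have h0 : lam * t ≠ 0 := (mul_pos hlam ht).ne'
  have h := Real.add_one_lt_exp h0
  have h2 : Real.exp (lam * t) * Real.exp (-(lam * t)) = 1 := by
    rw [← Real.exp_add, add_neg_cancel, Real.exp_zero]
  have h3 := Real.exp_pos (-(lam * t))
  unfold completionProb
  nlinarith

/-- The date minus the expected truncated completion date is strictly increasing. -/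
theorem strictMonoOn_sub_truncatedMean {lam : ℝ} (hlam : 0 < lam) :
    StrictMonoOn (fun s => s - truncatedMean lam s) (Set.Ici 0) := by
  have hd : ∀ s, HasDerivAt (fun s => s - truncatedMean lam s) (completionProb lam s) s := by
    intro s
    convert! (hasDerivAt_id s).sub (hasDerivAt_truncatedMean hlam s) using 1
    ring
  refine strictMonoOn_of_deriv_pos (convex_Ici 0)
    (fun s _ => (hd s).continuousAt.continuousWithinAt) fun s hs => ?_
  rw [interior_Ici] at hs
  rw [(hd s).deriv]
  exact completionProb_pos hlam hs

/-- The payoff from investing until the second stage is completed or date `t` is reached. -/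
noncomputable def fullInfoPayoff (lam v c t : ℝ) : ℝ :=
  completionProb lam t * v - truncatedMean lam t * c

theorem hasDerivAt_fullInfoPayoff {lam : ℝ} (hlam : 0 < lam) (v c t : ℝ) :
    HasDerivAt (fullInfoPayoff lam v c)
      (Real.exp (-(lam * t)) * (lam * (v * lam - c) * t - c)) t := by
  convert! ((hasDerivAt_completionProb lam t).mul_const v).sub
    ((hasDerivAt_truncatedMean hlam t).mul_const c) using 1
  unfold completionProb
  ring

/-- For c < vλ the derivative changes sign once, from negative to positive, at c / (λ(vλ - c)); `hs`
places `s` beyond that date. -/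
theorem fullInfoPayoff_mono {lam v c s t : ℝ} (hlam : 0 < lam) (hvc : c < v * lam)
    (hs : c ≤ lam * (v * lam - c) * s) (hst : s ≤ t) :
    fullInfoPayoff lam v c s ≤ fullInfoPayoff lam v c t := by
  refine monotoneOn_of_deriv_nonneg (convex_Icc s t)
    (fun x _ => (hasDerivAt_fullInfoPayoff hlam v c x).continuousAt.continuousWithinAt)
    (fun x _ => (hasDerivAt_fullInfoPayoff hlam v c x).differentiableAt.differentiableWithinAt)
    (fun x hx => ?_) (Set.left_mem_Icc.2 hst) (Set.right_mem_Icc.2 hst) hst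
  rw [interior_Icc] at hx
  rw [(hasDerivAt_fullInfoPayoff hlam v c x).deriv]
  have h1 : 0 < lam * (v * lam - c) := mul_pos hlam (sub_pos.2 hvc)
  have h2 := mul_le_mul_of_nonneg_left hx.1.le h1.le
  exact mul_nonneg (Real.exp_pos _).le (by linarith)

theorem fullInfoPayoff_anti {lam v c s t : ℝ} (hlam : 0 < lam) (hvc : c < v * lam)
    (ht : lam * (v * lam - c) * t ≤ c) (hst : s ≤ t) :
    fullInfoPayoff lam v c t ≤ fullInfoPayoff lam v c s := by
  refine antitoneOn_of_deriv_nonpos (convex_Icc s t)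
    (fun x _ => (hasDerivAt_fullInfoPayoff hlam v c x).continuousAt.continuousWithinAt)
    (fun x _ => (hasDerivAt_fullInfoPayoff hlam v c x).differentiableAt.differentiableWithinAt)
    (fun x hx => ?_) (Set.left_mem_Icc.2 hst) (Set.right_mem_Icc.2 hst) hst
  rw [interior_Icc] at hx
  rw [(hasDerivAt_fullInfoPayoff hlam v c x).deriv]
  have h1 : 0 < lam * (v * lam - c) := mul_pos hlam (sub_pos.2 hvc)
  have h2 := mul_le_mul_of_nonneg_left hx.2.le h1.le
  exact mul_nonpos_of_nonneg_of_nonpos (Real.exp_pos _).le (by linarith)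

/-- A function that falls and then rises is largest at an endpoint of an interval. This reduces
deviations to intermediate dates to deviations to the endpoints. -/
theorem fullInfoPayoff_le_max {lam v c s t u : ℝ} (hlam : 0 < lam) (hvc : c < v * lam)
    (hst : s ≤ t) (htu : t ≤ u) :
    fullInfoPayoff lam v c t ≤ max (fullInfoPayoff lam v c s) (fullInfoPayoff lam v c u) := by
  rcases le_total c (lam * (v * lam - c) * t) with h | h
  · exact le_max_of_le_right (fullInfoPayoff_mono hlam hvc h htu)
  · exact le_max_of_le_left (fullInfoPayoff_anti hlam hvc h hst)

/-- The payoff from stopping at the deterministic date `s`. -/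
noncomputable def deterministicPayoff (lam v c s : ℝ) : ℝ := completionProb lam s * v - s * c

/-- The payoff from investing until `s`, and then until the second stage is completed or date `t`
is reached. -/
noncomputable def delayedPayoff (lam v c s t : ℝ) : ℝ :=
  fullInfoPayoff lam v c t - (s - truncatedMean lam s) * c

theorem delayedPayoff_self (lam v c s : ℝ) :
    delayedPayoff lam v c s s = deterministicPayoff lam v c s := by
  unfold delayedPayoff fullInfoPayoff deterministicPayoff
  ring

theorem hasDerivAt_deterministicPayoff (lam v c s : ℝ) :
    HasDerivAt (deterministicPayoff lam v c)
      (lam ^ 2 * s * Real.exp (-(lam * s)) * v - c) s := by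
  simpa using! ((hasDerivAt_completionProb lam s).mul_const v).sub
    ((hasDerivAt_id s).mul_const c)

/-- The cutoff κ̃ is the break-even cost ratio of investing until τ₂ ∧ T: up to a positive factor,
`fullInfoPayoff` at `T` is κ̃ - κ. Since e^{λT} > 1 + λT, also κ̃ < 1, whence c < vλ. -/
theorem cost_lt_of_le_kappaTilde {lam v c : ℝ} {T : ℝ≥0} (hlam : 0 < lam) (hv : 0 < v)
    (hT : 0 < T) (h : c / (v * lam) ≤ kappaTilde T lam) :
    c < v * lam ∧ 0 ≤ fullInfoPayoff lam v c T := by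
  have hvl : 0 < v * lam := mul_pos hv hlam
  have hL : 0 < lam * (T : ℝ) := mul_pos hlam (by exact_mod_cast hT)
  have hexp := Real.add_one_lt_exp hL.ne'
  have hinv : Real.exp (lam * T) * Real.exp (-(lam * T)) = 1 := by
    rw [← Real.exp_add, add_neg_cancel, Real.exp_zero]
  set L := lam * (T : ℝ) with hLdef
  set y := Real.exp L with hy
  set z := Real.exp (-L) with hz
  have hz0 : 0 < z := Real.exp_pos _
  have hden : 0 < 2 * y - 2 - L := by linarith
  have hk : kappaTilde T lam = (y - 1 - L) / (2 * y - 2 - L) := by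
    unfold kappaTilde
    rw [← neg_div_neg_eq]
    congr 1 <;> ring
  rw [hk, div_le_div_iff₀ hvl hden] at h
  constructor
  · nlinarith
  · have hF : fullInfoPayoff lam v c T
        = z / lam * ((y - 1 - L) * (v * lam) - c * (2 * y - 2 - L)) := by
      unfold fullInfoPayoff completionProb truncatedMean
      rw [← hLdef, ← hz]
      field_simp
      linear_combination (2 * c - v * lam) * hinv
    rw [hF]
    exact mul_nonneg (div_pos hz0 hlam).le (by linarith)

/-! ### The disclosure date -/

/-- The date from which on the agent discloses the completion of the second stage. -/
theorem exists_disclosure_date {lam v c : ℝ} {T : ℝ≥0} (hlam : 0 < lam) (hv : 0 < v) (hc : 0 < c)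
    (hT : 0 < T) (hlow : kappaND T lam < c / (v * lam))
    (hhigh : c / (v * lam) ≤ kappaTilde T lam) :
    ∃ S : ℝ≥0, S < T ∧
      (∃ s ≤ T, deterministicPayoff lam v c s = delayedPayoff lam v c S T) ∧
      (∀ s ≤ T, deterministicPayoff lam v c s ≤ delayedPayoff lam v c S T) ∧
      (∀ s ≤ T, deterministicPayoff lam v c s = delayedPayoff lam v c S T → s ≤ S) ∧
      ∀ t ≤ T, S ≤ t → delayedPayoff lam v c S t ≤ delayedPayoff lam v c S T := by
  obtain ⟨hvc, hfull⟩ := cost_lt_of_le_kappaTilde hlam hv hT hhigh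
  have hT' : (0 : ℝ) < T := by exact_mod_cast hT
  have hcont : Continuous (deterministicPayoff lam v c) :=
    continuous_iff_continuousAt.2 fun s => (hasDerivAt_deterministicPayoff lam v c s).continuousAt
  obtain ⟨m, hm, hmax⟩ := isCompact_Icc.exists_isMaxOn (Set.nonempty_Icc.2 hT'.le)
    hcont.continuousOn
  -- the payoff of deterministic dates is strictly decreasing at the deadline
  have hneg : lam ^ 2 * T * Real.exp (-(lam * T)) * v - c < 0 := by
    unfold kappaND at hlow
    rw [lt_div_iff₀ (mul_pos hv hlam)] at hlow
    linarith
  have hlt : deterministicPayoff lam v c T < deterministicPayoff lam v c m := by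
    -- A negative derivative at `T` yields some x in (0, T) with a payoff above that of `T`.
    have hslope := hasDerivAt_iff_tendsto_slope.1 (hasDerivAt_deterministicPayoff lam v c T)
    have hev := (hslope.mono_left
      (nhdsWithin_mono _ (s := Set.Iio (T : ℝ)) fun x hx => ne_of_lt hx)).eventually (gt_mem_nhds hneg)
    have hev' : ∀ᶠ x in nhdsWithin (T : ℝ) (Set.Iio T), x ∈ Set.Ioo 0 (T : ℝ) :=
      Ioo_mem_nhdsLT hT'
    obtain ⟨x, hx, hx0, hxT⟩ := (hev.and hev').exists
    rw [slope_def_field, div_neg_iff] at hx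
    have h1 : deterministicPayoff lam v c x ≤ deterministicPayoff lam v c m :=
      hmax ⟨hx0.le, hxT.le⟩
    rcases hx with hx | hx <;> linarith
  have hmT : m < T := lt_of_le_of_ne hm.2 fun h => hlt.ne (by rw [h])
  -- waiting for the second stage after a maximizer is profitable
  have hfirst : ∀ s ∈ Set.Icc 0 (T : ℝ),
      deterministicPayoff lam v c s = deterministicPayoff lam v c m →
        deterministicPayoff lam v c s ≤ delayedPayoff lam v c s T := by
    intro s hs hsm
    -- At date 0 there is no first-order condition; the claim is then that `fullInfoPayoff` at `T`
    -- is nonnegative.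
    rcases hs.1.eq_or_lt with h0 | h0
    · simpa [← h0, delayedPayoff, deterministicPayoff] using hfull
    have hsT : s < T := lt_of_le_of_ne hs.2 fun h => hlt.ne (by rw [← hsm, h])
    have hloc : IsLocalMax (deterministicPayoff lam v c) s := by
      filter_upwards [Icc_mem_nhds h0 hsT] with x hx
      rw [hsm]
      exact hmax hx
    -- The first-order condition reads λ²sv = c e^{λs} ≥ c(1 + λs), which rearranges to c ≤ λ(vλ -
    -- c)s: from `s` on, `fullInfoPayoff` increases.
    have hfoc := hloc.hasDerivAt_eq_zero (hasDerivAt_deterministicPayoff lam v c s)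
    have hinv : Real.exp (lam * s) * Real.exp (-(lam * s)) = 1 := by
      rw [← Real.exp_add, add_neg_cancel, Real.exp_zero]
    have hexp := Real.add_one_le_exp (lam * s)
    have hk : c ≤ lam * (v * lam - c) * s := by
      have h1 : lam ^ 2 * s * v = c * Real.exp (lam * s) := by
        linear_combination Real.exp (lam * s) * hfoc - lam ^ 2 * s * v * hinv
      nlinarith
    have h2 := fullInfoPayoff_mono hlam hvc hk hs.2
    rw [← delayedPayoff_self]
    unfold delayedPayoff
    linarith
  have hcontD : Continuous fun s => delayedPayoff lam v c s T := by
    have hG : Continuous (truncatedMean lam) :=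
      continuous_iff_continuousAt.2 fun s => (hasDerivAt_truncatedMean hlam s).continuousAt
    unfold delayedPayoff
    fun_prop
  have hmem : deterministicPayoff lam v c m ∈
      Set.Icc (delayedPayoff lam v c T T) (delayedPayoff lam v c m T) :=
    ⟨by rw [delayedPayoff_self]; exact hlt.le, hfirst m hm rfl⟩
  -- `S` is the date in [m, T] at which delayed disclosure is worth exactly the no-information
  -- payoff.
  obtain ⟨S, hS, hSeq⟩ := intermediate_value_Icc' hm.2 hcontD.continuousOn hmem
  simp only at hSeq
  have hS0 : 0 ≤ S := hm.1.trans hS.1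
  lift S to ℝ≥0 using hS0
  refine ⟨S, ?_, ⟨⟨m, hm.1⟩, hm.2, hSeq.symm⟩, fun s hs => ?_, fun s hs hsS => ?_,
    fun t ht hSt => ?_⟩
  · refine lt_of_le_of_ne (by exact_mod_cast hS.2) fun h => ?_
    rw [h, delayedPayoff_self] at hSeq
    exact hlt.ne hSeq
  · rw [hSeq]
    exact hmax ⟨s.2, hs⟩
  · by_contra hlt'
    have h1 : (S : ℝ) - truncatedMean lam S < s - truncatedMean lam s :=
      strictMonoOn_sub_truncatedMean hlam S.2 s.2
        (show (S : ℝ) < s by exact_mod_cast not_le.1 hlt')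
    have h2 := hfirst s ⟨s.2, hs⟩ (hsS.trans hSeq)
    rw [hsS] at h2
    have h3 := mul_lt_mul_of_pos_right h1 hc
    unfold delayedPayoff at h2
    linarith
  -- The cost of the uninformed phase does not depend on `t`, so only the endpoints t = S and t = T
  -- matter; the former is a deterministic date.
  · have h1 := fullInfoPayoff_le_max hlam hvc (show (S : ℝ) ≤ t from hSt) (show (t : ℝ) ≤ T from ht)
    have h2 : delayedPayoff lam v c S S ≤ delayedPayoff lam v c S T := by
      rw [hSeq, delayedPayoff_self]
      exact hmax ⟨S.2, hS.2⟩
    unfold delayedPayoff at h2 ⊢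
    rcases le_max_iff.1 h1 with h | h <;> linarith

/-! ### Law of the completion date -/

theorem integral_sub_exp_neg {lam : ℝ} {t : ℝ} (ht : 0 ≤ t) :
    ∫ x in Set.Icc 0 t, (lam * Real.exp (-(lam * x)) - lam * Real.exp (-(lam * t)))
      = completionProb lam t := by
  rw [integral_Icc_eq_integral_Ioc, ← intervalIntegral.integral_of_le ht,
    intervalIntegral.integral_eq_sub_of_hasDerivAt
      (f := fun x => -Real.exp (-(lam * x)) - x * (lam * Real.exp (-(lam * t))))]
  · simp [completionProb]
    ring
  · intro x _
    convert! (hasDerivAt_exp_neg_mul lam x).neg.sub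
      ((hasDerivAt_id x).mul_const (lam * Real.exp (-(lam * t)))) using 1
    ring
  · exact Continuous.intervalIntegrable (by fun_prop) _ _

/-- The law of the sum of two independent exponential variables. -/
theorem expMeasure_prod_sum_le {lam : ℝ} (hlam : 0 < lam) {t : ℝ} (ht : 0 ≤ t) :
    ((expMeasure lam).prod (expMeasure lam)) {p | p.1 + p.2 ≤ t}
      = ENNReal.ofReal (completionProb lam t) := by
  have := isProbabilityMeasure_expMeasure hlam
  have hms : MeasurableSet {p : ℝ × ℝ | p.1 + p.2 ≤ t} :=
    measurableSet_le (measurable_fst.add measurable_snd) measurable_const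
  rw [Measure.prod_apply hms]
  have hpre : ∀ x : ℝ, Prod.mk x ⁻¹' {p : ℝ × ℝ | p.1 + p.2 ≤ t} = Set.Iic (t - x) := by
    intro x
    ext y
    simp only [Set.mem_preimage, Set.mem_ofPred_eq, Set.mem_Iic]
    constructor <;> intro h <;> linarith
  simp_rw [hpre, ← ofReal_cdf, cdf_expMeasure_eq hlam]
  have hmeas : Measurable fun x : ℝ => ENNReal.ofReal
      (if 0 ≤ t - x then 1 - Real.exp (-(lam * (t - x))) else 0) := by
    refine ENNReal.measurable_ofReal.comp (Measurable.ite ?_ (by fun_prop) measurable_const)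
    exact measurableSet_le measurable_const (by fun_prop)
  have hpdf : Measurable (exponentialPDF lam) :=
    ENNReal.measurable_ofReal.comp (measurable_exponentialPDFReal lam)
  have hexp : expMeasure lam = volume.withDensity (exponentialPDF lam) := rfl
  rw [hexp, lintegral_withDensity_eq_lintegral_mul _ hpdf hmeas]
  have hprod : ∀ x : ℝ, (exponentialPDF lam * fun x : ℝ => ENNReal.ofReal
      (if 0 ≤ t - x then 1 - Real.exp (-(lam * (t - x))) else 0)) x
      = (Set.Icc 0 t).indicator (fun x => ENNReal.ofReal
        (lam * Real.exp (-(lam * x)) - lam * Real.exp (-(lam * t)))) x := by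
    intro x
    simp only [Pi.mul_apply, exponentialPDF_eq, Set.indicator_apply, Set.mem_Icc]
    by_cases h0 : 0 ≤ x
    · by_cases h1 : x ≤ t
      · rw [if_pos h0, if_pos (sub_nonneg.2 h1), if_pos ⟨h0, h1⟩,
          ← ENNReal.ofReal_mul (mul_pos hlam (Real.exp_pos _)).le, mul_sub, mul_one, mul_assoc,
          ← Real.exp_add]
        congr 5
        ring
      · rw [if_neg (fun h => h1 (sub_nonneg.1 h)),
          if_neg (fun h : 0 ≤ x ∧ x ≤ t => h1 h.2)]
        simp
    · rw [if_neg h0, if_neg (fun h : 0 ≤ x ∧ x ≤ t => h0 h.1)]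
      simp
  simp_rw [hprod]
  rw [lintegral_indicator measurableSet_Icc, ← integral_sub_exp_neg ht,
    ofReal_integral_eq_lintegral_ofReal]
  · exact (by fun_prop : Continuous fun x : ℝ => lam * Real.exp (-(lam * x))
      - lam * Real.exp (-(lam * t))).continuousOn.integrableOn_Icc
  · refine (ae_restrict_iff' measurableSet_Icc).2 (Filter.Eventually.of_forall fun x hx => ?_)
    have : Real.exp (-(lam * t)) ≤ Real.exp (-(lam * x)) :=
      Real.exp_le_exp.2 (neg_le_neg (mul_le_mul_of_nonneg_left hx.2 hlam.le))
    simp only [Pi.zero_apply]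
    nlinarith

variable {Ω : Type*} [mΩ : MeasurableSpace Ω] {P : Measure Ω} {lam : ℝ}

namespace Project

theorem measurable_completion₂ (X : Project P lam) : Measurable X.completion₂ :=
  X.measurable_wait₁.add X.measurable_wait₂

theorem state_eq_two_iff (X : Project P lam) (t : ℝ≥0) (ω : Ω) :
    X.state t ω = 2 ↔ X.completion₂ ω ≤ t := by
  unfold state
  split_ifs with h1 h2 <;> simp [h1]

theorem measureReal_completion₂_le [IsProbabilityMeasure P] (X : Project P lam) (hlam : 0 < lam)
    (t : ℝ≥0) : P.real {ω | X.completion₂ ω ≤ t} = completionProb lam t := by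
  have hind : IndepFun (fun ω => (X.wait₁ ω : ℝ)) (fun ω => (X.wait₂ ω : ℝ)) P :=
    X.indep.comp measurable_coe_nnreal_real measurable_coe_nnreal_real
  have h1 := X.measurable_wait₁.coe_nnreal_real
  have h2 := X.measurable_wait₂.coe_nnreal_real
  have hmap := (indepFun_iff_map_prod_eq_prod_map_map h1.aemeasurable h2.aemeasurable).1 hind
  rw [X.law_wait₁, X.law_wait₂] at hmap
  have hms : MeasurableSet {p : ℝ × ℝ | p.1 + p.2 ≤ t} :=
    measurableSet_le (measurable_fst.add measurable_snd) measurable_const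
  have hset : {ω | X.completion₂ ω ≤ t}
      = (fun ω => ((X.wait₁ ω : ℝ), (X.wait₂ ω : ℝ))) ⁻¹' {p | p.1 + p.2 ≤ t} := by
    ext ω
    simp only [Set.mem_ofPred_eq, Set.mem_preimage, completion₂]
    norm_cast
  rw [hset, measureReal_def, ← Measure.map_apply (h1.prodMk h2) hms, hmap,
    expMeasure_prod_sum_le hlam (NNReal.coe_nonneg t), ENNReal.toReal_ofReal]
  rcases (bot_le : 0 ≤ t).eq_or_lt with h | h
  · simp [← h]
  · exact (completionProb_pos hlam (by exact_mod_cast h)).le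

theorem integral_min_completion₂ [IsProbabilityMeasure P] (X : Project P lam) (hlam : 0 < lam)
    (t : ℝ≥0) : ∫ ω, ((min (X.completion₂ ω) t : ℝ≥0) : ℝ) ∂P = truncatedMean lam t := by
  have hmeas : Measurable fun ω => ((min (X.completion₂ ω) t : ℝ≥0) : ℝ) :=
    (X.measurable_completion₂.min measurable_const).coe_nnreal_real
  have hint : Integrable (fun ω => ((min (X.completion₂ ω) t : ℝ≥0) : ℝ)) P := by
    refine Integrable.of_bound hmeas.aestronglyMeasurable t (Filter.Eventually.of_forall fun ω => ?_)
    rw [Real.norm_of_nonneg (NNReal.coe_nonneg _)]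
    exact_mod_cast min_le_right _ _
  -- Layer cake: the mean is the integral of the tail, which is 1 - `completionProb` before `t` and
  -- 0 afterwards, and `truncatedMean` is a primitive of that.
  rw [hint.integral_eq_integral_meas_lt (Filter.Eventually.of_forall fun ω => NNReal.coe_nonneg _)]
  have htail : ∀ u ∈ Set.Ioi (0 : ℝ), P.real {ω | u < ((min (X.completion₂ ω) t : ℝ≥0) : ℝ)}
      = (Set.Ioo 0 (t : ℝ)).indicator (fun u => 1 - completionProb lam u) u := by
    intro u hu
    rw [Set.mem_Ioi] at hu
    lift u to ℝ≥0 using hu.le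
    by_cases hut : u < t
    · rw [Set.indicator_of_mem (by exact ⟨hu, hut⟩), ← X.measureReal_completion₂_le hlam u,
        ← probReal_compl_eq_one_sub (measurableSet_le X.measurable_completion₂ measurable_const)]
      congr 1
      ext ω
      simp [hut]
    · rw [Set.indicator_of_notMem (fun h => hut (by exact_mod_cast h.2))]
      convert! measureReal_empty
      ext ω
      simp only [Set.mem_ofPred_eq, NNReal.coe_lt_coe, lt_min_iff, hut, and_false]
      rfl
  rw [setIntegral_congr_fun measurableSet_Ioi htail, setIntegral_indicator measurableSet_Ioo,
    Set.inter_eq_right.2 (fun x hx => hx.1), ← integral_Ioc_eq_integral_Ioo,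
    ← intervalIntegral.integral_of_le (NNReal.coe_nonneg t),
    intervalIntegral.integral_eq_sub_of_hasDerivAt
      (fun x _ => hasDerivAt_truncatedMean hlam x), truncatedMean_zero, sub_zero]
  · have : Continuous (completionProb lam) :=
      continuous_iff_continuousAt.2 fun s => (hasDerivAt_completionProb lam s).continuousAt
    exact Continuous.intervalIntegrable (by fun_prop) _ _

/-! ### Expected payoffs and continuation values -/

theorem realizedPayoff_eq (X : Project P lam) (v c : ℝ) (ρ : Ω → ℝ≥0) (ω : Ω) :
    X.realizedPayoff v c ρ ω
      = ({ω | X.completion₂ ω ≤ ρ ω}.indicator (fun _ => v) ω) - c * (ρ ω : ℝ) := by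
  simp [realizedPayoff, state_eq_two_iff, Set.indicator_apply]

theorem integrable_coe_of_le [IsFiniteMeasure P] {ρ : Ω → ℝ≥0} {T : ℝ≥0} (hρ : Measurable ρ)
    (hT : ∀ ω, ρ ω ≤ T) : Integrable (fun ω => (ρ ω : ℝ)) P := by
  refine Integrable.of_bound hρ.coe_nnreal_real.aestronglyMeasurable T
    (Filter.Eventually.of_forall fun ω => ?_)
  rw [Real.norm_of_nonneg (NNReal.coe_nonneg _)]
  exact_mod_cast hT ω

theorem integrable_realizedPayoff [IsFiniteMeasure P] (X : Project P lam) (v c : ℝ)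
    {ρ : Ω → ℝ≥0} {T : ℝ≥0} (hρ : Measurable ρ) (hT : ∀ ω, ρ ω ≤ T) :
    Integrable (X.realizedPayoff v c ρ) P := by
  rw [funext (X.realizedPayoff_eq v c ρ)]
  exact ((integrable_const v).indicator (measurableSet_le X.measurable_completion₂ hρ)).sub
    ((integrable_coe_of_le hρ hT).const_mul c)

theorem integral_realizedPayoff_eq [IsFiniteMeasure P] (X : Project P lam) (v c : ℝ)
    {ρ : Ω → ℝ≥0} {T : ℝ≥0} (hρ : Measurable ρ) (hT : ∀ ω, ρ ω ≤ T) :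
    ∫ ω, X.realizedPayoff v c ρ ω ∂P = X.principalPayoff v c ρ := by
  have hms : MeasurableSet {ω | X.completion₂ ω ≤ ρ ω} :=
    measurableSet_le X.measurable_completion₂ hρ
  simp_rw [realizedPayoff_eq]
  rw [integral_sub ((integrable_const v).indicator hms) ((integrable_coe_of_le hρ hT).const_mul c),
    integral_indicator_const _ hms, integral_const_mul]
  simp only [principalPayoff, state_eq_two_iff, smul_eq_mul]
  ring

/-- The continuation value is the gain from following `ρ` instead of stopping at `t`, averaged
over the event that `t` is reached. -/
theorem continuationValue_eq [IsProbabilityMeasure P] (X : Project P lam) (v c : ℝ)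
    {ρ : Ω → ℝ≥0} {T : ℝ≥0} (hρ : Measurable ρ) (hT : ∀ ω, ρ ω ≤ T) (t : ℝ≥0) :
    X.continuationValue v c ρ t = (P.real {ω | t < ρ ω})⁻¹ *
      (X.principalPayoff v c ρ - X.principalPayoff v c (fun ω => min t (ρ ω))) := by
  have hA : MeasurableSet {ω | t < ρ ω} := measurableSet_lt measurable_const hρ
  have hmin : Measurable fun ω => min t (ρ ω) := measurable_const.min hρ
  have hminT : ∀ ω, min t (ρ ω) ≤ T := fun ω => (min_le_right _ _).trans (hT ω)
  have hms1 : MeasurableSet {ω | X.completion₂ ω ≤ ρ ω} :=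
    measurableSet_le X.measurable_completion₂ hρ
  have hms2 : MeasurableSet {ω | X.completion₂ ω ≤ t} :=
    measurableSet_le X.measurable_completion₂ measurable_const
  have hi1 := X.integrable_realizedPayoff (P := P) v c hρ hT
  have hi2 := X.integrable_realizedPayoff (P := P) v c hmin hminT
  have hcond : X.continuationValue v c ρ t = ∫ ω, (X.realizedPayoff v c ρ ω
      - X.realizedPayoff v c (fun _ => t) ω) ∂(ProbabilityTheory.cond P {ω | t < ρ ω}) := by
    have hfin : IsFiniteMeasure (ProbabilityTheory.cond P {ω | t < ρ ω}) := by
      -- If `t` is reached with probability zero, the conditional measure is zero and so is the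
      -- inverse in the claim; the identity needs no positivity.
      by_cases h : P {ω | t < ρ ω} = 0
      · rw [cond_eq_zero_of_meas_eq_zero h]
        infer_instance
      · have := cond_isProbabilityMeasure h
        infer_instance
    have hj1 : Integrable (fun ω => {ω | X.completion₂ ω ≤ ρ ω}.indicator (fun _ => v) ω)
      (ProbabilityTheory.cond P {ω | t < ρ ω}) := (integrable_const v).indicator hms1
    have hj2 : Integrable (fun ω => {ω | X.completion₂ ω ≤ t}.indicator (fun _ => v) ω)
      (ProbabilityTheory.cond P {ω | t < ρ ω}) := (integrable_const v).indicator hms2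
    have hj12 : Integrable (fun ω => {ω | X.completion₂ ω ≤ ρ ω}.indicator (fun _ => v) ω
      - {ω | X.completion₂ ω ≤ t}.indicator (fun _ => v) ω)
        (ProbabilityTheory.cond P {ω | t < ρ ω}) := hj1.sub hj2
    have hj3 : Integrable (fun ω => ((ρ ω : ℝ) - t)) (ProbabilityTheory.cond P {ω | t < ρ ω}) :=
      (integrable_coe_of_le hρ hT).sub (integrable_const _)
    have heq : ∀ ω, X.realizedPayoff v c ρ ω - X.realizedPayoff v c (fun _ => t) ω
        = {ω | X.completion₂ ω ≤ ρ ω}.indicator (fun _ => v) ω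
          - {ω | X.completion₂ ω ≤ t}.indicator (fun _ => v) ω - c * ((ρ ω : ℝ) - t) := by
      intro ω
      rw [realizedPayoff_eq, realizedPayoff_eq]
      ring
    simp_rw [heq]
    rw [integral_sub hj12 (hj3.const_mul c), integral_sub hj1 hj2, integral_const_mul,
      integral_indicator_const _ hms1, integral_indicator_const _ hms2]
    simp only [continuationValue, state_eq_two_iff, smul_eq_mul]
    ring
  have hset : ∫ ω in {ω | t < ρ ω}, (X.realizedPayoff v c ρ ω
      - X.realizedPayoff v c (fun _ => t) ω) ∂P = X.principalPayoff v c ρ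
        - X.principalPayoff v c (fun ω => min t (ρ ω)) := by
    -- Where `t` is not reached, truncating at `t` changes nothing, so the difference of the
    -- unconditional payoffs lives on {t < ρ}.
    rw [← X.integral_realizedPayoff_eq v c hρ hT, ← X.integral_realizedPayoff_eq v c hmin hminT,
      ← integral_sub hi1 hi2, ← integral_indicator hA]
    refine integral_congr_ae (Filter.Eventually.of_forall fun ω => ?_)
    by_cases h : t < ρ ω
    · rw [Set.indicator_of_mem (by exact h)]
      simp [realizedPayoff, min_eq_left h.le]
    · rw [Set.indicator_of_notMem (by exact h)]
      simp [realizedPayoff, min_eq_right (not_lt.1 h)]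
  rw [hcond, ProbabilityTheory.cond, integral_smul_measure, hset, smul_eq_mul, ENNReal.toReal_inv]
  rfl

theorem principalPayoff_const [IsProbabilityMeasure P] (X : Project P lam) (hlam : 0 < lam)
    (v c : ℝ) (s : ℝ≥0) :
    X.principalPayoff v c (fun _ => s) = deterministicPayoff lam v c s := by
  simp only [principalPayoff, state_eq_two_iff, X.measureReal_completion₂_le hlam,
    deterministicPayoff]
  simp

/-- The payoff from investing until `s`, and then until completion or date `t`. -/
theorem principalPayoff_max_min [IsProbabilityMeasure P] (X : Project P lam) (hlam : 0 < lam)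
    (v c : ℝ) {s t : ℝ≥0} (hst : s ≤ t) :
    X.principalPayoff v c (fun ω => max s (min (X.completion₂ ω) t))
      = delayedPayoff lam v c s t := by
  have hset : {ω | X.state (max s (min (X.completion₂ ω) t)) ω = 2}
      = {ω | X.completion₂ ω ≤ t} := by
    ext ω
    simp only [state_eq_two_iff, Set.mem_ofPred_eq, le_max_iff, le_min_iff, le_refl, true_and]
    exact ⟨fun h => h.elim (fun h => h.trans hst) id, Or.inr⟩
  -- The schedule adds to the date `s` the time spent waiting for completion between `s` and `t`.
  have hval : ∀ ω, ((max s (min (X.completion₂ ω) t) : ℝ≥0) : ℝ)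
      = s + ((min (X.completion₂ ω) t : ℝ≥0) : ℝ) - ((min (X.completion₂ ω) s : ℝ≥0) : ℝ) := by
    intro ω
    have : (s : ℝ) ≤ t := hst
    rcases le_total (X.completion₂ ω) s with h | h
    · rw [min_eq_left h, min_eq_left (h.trans hst), max_eq_left h]
      ring
    · rw [min_eq_right h, max_eq_right (le_min h hst)]
      ring
  have hint : ∀ u : ℝ≥0, Integrable (fun ω => ((min (X.completion₂ ω) u : ℝ≥0) : ℝ)) P :=
    fun u => integrable_coe_of_le (X.measurable_completion₂.min measurable_const)
      fun ω => min_le_right _ _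
  have hadd : Integrable (fun ω => (s : ℝ) + ((min (X.completion₂ ω) t : ℝ≥0) : ℝ)) P :=
    (integrable_const _).add (hint t)
  simp_rw [principalPayoff, hset, hval]
  rw [integral_sub hadd (hint s),
    integral_add (integrable_const _) (hint t), X.integral_min_completion₂ hlam,
    X.integral_min_completion₂ hlam, X.measureReal_completion₂_le hlam]
  simp only [integral_const, probReal_univ, smul_eq_mul, one_mul, delayedPayoff, fullInfoPayoff]
  ring

/-- The agent's payoff from a schedule that the principal does not want to abandon in favour of
stopping at `s`. -/
theorem agentPayoff_le [IsProbabilityMeasure P] (X : Project P lam) (hlam : 0 < lam) {v c : ℝ}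
    (hv : 0 < v) (hc : 0 < c) {ρ : Ω → ℝ≥0} {s T : ℝ≥0} (hρ : Measurable ρ) (hT : ∀ ω, ρ ω ≤ T)
    (hs : s ≤ T)
    (h : X.principalPayoff v c (fun ω => min s (ρ ω)) ≤ X.principalPayoff v c ρ) :
    X.agentPayoff c ρ ≤ completionProb lam T * v - X.principalPayoff v c (fun _ => s) := by
  have hmin : Measurable fun ω => min s (ρ ω) := measurable_const.min hρ
  -- Inclusion-exclusion: success by `ρ` or by `s` means success by `T`, and success by both means
  -- success by their minimum. So going on beyond s ∧ ρ adds at most p(T) - p(s) to the success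
  -- probability.
  have hprob : P.real {ω | X.completion₂ ω ≤ ρ ω} + P.real {ω | X.completion₂ ω ≤ s}
      ≤ P.real {ω | X.completion₂ ω ≤ T} + P.real {ω | X.completion₂ ω ≤ min s (ρ ω)} := by
    have hms : MeasurableSet {ω | X.completion₂ ω ≤ s} :=
      measurableSet_le X.measurable_completion₂ measurable_const
    rw [← measureReal_union_add_inter (s := {ω | X.completion₂ ω ≤ ρ ω}) hms]
    refine add_le_add (measureReal_mono ?_) (measureReal_mono ?_)
    · rintro ω (h1 | h1)
      · exact le_trans h1 (hT ω)
      · exact le_trans h1 hs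
    · rintro ω ⟨h1, h2⟩
      exact le_min (c := X.completion₂ ω) h2 h1
  have hmean : ∫ ω, ((min s (ρ ω) : ℝ≥0) : ℝ) ∂P ≤ s := by
    have h1 := integral_mono (μ := P) (integrable_coe_of_le hmin fun ω => min_le_left s (ρ ω))
      (integrable_const (s : ℝ)) (fun ω => NNReal.coe_le_coe.2 (min_le_left s (ρ ω)))
    simpa using h1
  rw [X.measureReal_completion₂_le hlam T] at hprob
  simp only [principalPayoff, state_eq_two_iff, agentPayoff, integral_const, probReal_univ,
    smul_eq_mul, one_mul] at h ⊢
  nlinarith [mul_le_mul_of_nonneg_right hprob hv.le, mul_le_mul_of_nonneg_right hmean hc.le]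

end Project

/-! ### Strategies under a recommendation mechanism -/

theorem measurable_of_isStoppingTime {f : Filtration ℝ≥0 mΩ} {ρ : Ω → ℝ≥0}
    (h : IsStoppingTime f fun ω => (ρ ω : WithTop ℝ≥0)) : Measurable ρ := by
  refine measurable_of_Iic fun t => ?_
  have h1 := f.le t _ (h t)
  simp only [WithTop.coe_le_coe] at h1
  exact h1

theorem InvestmentSchedule.measurable_time {X : Project P lam} {T : ℝ≥0}
    (τ : InvestmentSchedule X T) : Measurable τ.time :=
  measurable_of_isStoppingTime τ.isStoppingTime

theorem IsStrategy.measurable {X : Project P lam} {M : Type*} [MeasurableSpace M]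
    {σ : InformationPolicy X M} {T : ℝ≥0} {ρ : Ω → ℝ≥0} (h : IsStrategy σ T ρ) : Measurable ρ :=
  measurable_of_isStoppingTime h.isStoppingTime

theorem isStrategy_const {X : Project P lam} {M : Type*} [MeasurableSpace M]
    (σ : InformationPolicy X M) {s T : ℝ≥0} (hs : s ≤ T) : IsStrategy σ T fun _ => s :=
  ⟨fun _ => hs, isStoppingTime_const _ s⟩

namespace InvestmentSchedule

variable {X : Project P lam} {T : ℝ≥0}

/-- Where t < τ, all messages up to `t` are "continue", so the information at `t` has a trivial
trace on this event. -/
theorem mechanism_filtration_comap [IsProbabilityMeasure P] (τ : InvestmentSchedule X T) (t : ℝ≥0) :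
    (τ.mechanism.filtration t : MeasurableSpace Ω).comap
      (Subtype.val : {ω | t < τ.time ω} → Ω) = ⊥ := by
  have h : (τ.mechanism.filtration t : MeasurableSpace Ω)
      = ⨆ s ≤ t, (inferInstance : MeasurableSpace (Fin 2)).comap (τ.recommendation s) := rfl
  rw [h, MeasurableSpace.comap_iSup]
  simp_rw [MeasurableSpace.comap_iSup]
  refine le_bot_iff.1 (iSup₂_le fun s hs => ?_)
  rw [MeasurableSpace.comap_comp]
  have hconst : τ.recommendation s ∘ (Subtype.val : {ω | t < τ.time ω} → Ω) = fun _ => 1 := by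
    ext ω
    simp [recommendation, lt_of_le_of_lt hs ω.2]
  rw [hconst, MeasurableSpace.comap_const]

/-- As long as continuing is recommended the recommendations carry no further information: the
event that `t` is reached is an atom of the information at `t`. -/
theorem reached_subset_or_disjoint [IsProbabilityMeasure P] (τ : InvestmentSchedule X T)
    {t : ℝ≥0} {B : Set Ω} (hB : MeasurableSet[τ.mechanism.filtration t] B) :
    {ω | t < τ.time ω} ⊆ B ∨ Disjoint {ω | t < τ.time ω} B := by
  have h : MeasurableSet[(τ.mechanism.filtration t : MeasurableSpace Ω).comap
      (Subtype.val : {ω | t < τ.time ω} → Ω)] (Subtype.val ⁻¹' B) := ⟨B, hB, rfl⟩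
  rw [mechanism_filtration_comap, MeasurableSpace.measurableSet_bot_iff] at h
  rcases h with h | h
  · rw [Set.preimage_eq_empty_iff, Subtype.range_coe] at h
    exact Or.inr h.symm
  · rw [Set.preimage_eq_univ_iff, Subtype.range_coe] at h
    exact Or.inl h

theorem measurableSet_reached [IsProbabilityMeasure P] (τ : InvestmentSchedule X T) (t : ℝ≥0) :
    MeasurableSet[τ.mechanism.filtration t] {ω | t < τ.time ω} := by
  have h : MeasurableSet[τ.mechanism.filtration t] (τ.recommendation t ⁻¹' {1}) :=
    le_iSup₂ (f := fun s (_ : s ≤ t) =>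
      (inferInstance : MeasurableSpace (Fin 2)).comap (τ.recommendation s)) t le_rfl _
      ⟨{1}, measurableSet_singleton _, rfl⟩
  convert! h using 1
  ext ω
  simp [recommendation]

/-- Before the recommended date, the principal can only choose a deterministic date. -/
theorem exists_min_eq_min [IsProbabilityMeasure P] (τ : InvestmentSchedule X T) {ρ : Ω → ℝ≥0}
    (hρ : IsStrategy τ.mechanism T ρ) {t : ℝ≥0} (htT : t ≤ T) (ht : ∀ ω, t ≤ ρ ω) :
    ∃ r, t ≤ r ∧ r ≤ T ∧ ∀ ω, min (ρ ω) (τ.time ω) = min r (τ.time ω) := by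
  -- The event that `ρ` has stopped by the date ρ(ω) is known at that date and contains ω, so it
  -- contains the whole atom of outcomes where that date is still before τ.
  have key : ∀ ω ω', ρ ω < τ.time ω → ρ ω < τ.time ω' → ρ ω' ≤ ρ ω := by
    intro ω ω' h h'
    have hB := hρ.isStoppingTime (ρ ω)
    rcases τ.reached_subset_or_disjoint hB with hs | hs
    · simpa only [Set.mem_ofPred_eq, WithTop.coe_le_coe] using hs h'
    · exact absurd (le_refl (ρ ω : WithTop ℝ≥0)) (Set.disjoint_left.1 hs h)
  -- By `key`, `ρ` has a single value where it stops before τ; this is `r`. If it never does so, the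
  -- deadline serves.
  by_cases hex : ∃ ω, ρ ω < τ.time ω
  · obtain ⟨ω₀, h₀⟩ := hex
    refine ⟨ρ ω₀, ht ω₀, hρ.le_deadline ω₀, fun ω => ?_⟩
    rcases lt_or_ge (ρ ω) (τ.time ω) with h | h
    · have heq : ρ ω = ρ ω₀ := by
        rcases le_total (ρ ω) (ρ ω₀) with hle | hle
        · exact le_antisymm hle (key ω ω₀ h (hle.trans_lt h₀))
        · exact le_antisymm (key ω₀ ω h₀ (hle.trans_lt h)) hle
      rw [heq]
    · rw [min_eq_right h, min_eq_right]
      by_contra hlt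
      exact (key ω₀ ω h₀ (not_le.1 hlt)).not_gt ((not_le.1 hlt).trans_le h)
  · push Not at hex
    exact ⟨T, htT, le_rfl, fun ω => by rw [min_eq_right (hex ω), min_eq_right (τ.le_deadline ω)]⟩

end InvestmentSchedule

/-! ### The delayed disclosure schedule -/

namespace Project

theorem measurableSet_completion₂_le (X : Project P lam) (t : ℝ≥0) :
    MeasurableSet[X.filtration t] {ω | X.completion₂ ω ≤ t} := by
  have h : MeasurableSet[X.filtration t] (X.state t ⁻¹' {2}) :=
    le_iSup₂ (f := fun s (_ : s ≤ t) =>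
      (inferInstance : MeasurableSpace ℕ).comap (X.state s)) t le_rfl _
      ⟨{2}, measurableSet_singleton _, rfl⟩
  convert! h using 1
  ext ω
  simp [state_eq_two_iff]

/-- Invest until `S`, and then until the second stage is completed or the deadline is reached. -/
noncomputable def delayedDisclosure (X : Project P lam) {S T : ℝ≥0} (hST : S ≤ T) :
    InvestmentSchedule X T where
  time ω := max S (min (X.completion₂ ω) T)
  le_deadline ω := max_le hST (min_le_right _ _)
  isStoppingTime t := by
    simp only [WithTop.coe_le_coe, max_le_iff, min_le_iff]
    by_cases hS : S ≤ t
    · by_cases hT : T ≤ t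
      · simp [hS, hT]
      · simpa [hS, hT] using X.measurableSet_completion₂_le t
    · simp [hS]

end Project

/-! ### Obedience and best replies -/

namespace InvestmentSchedule

variable {X : Project P lam} {T : ℝ≥0}

/-- Investing beyond the date recommended by a schedule that waits for the second stage is a pure
waste. -/
theorem realizedPayoff_min_time {τ : InvestmentSchedule X T}
    (hwait : ∀ ω, min (X.completion₂ ω) T ≤ τ.time ω) (v c : ℝ) {ρ : Ω → ℝ≥0} {ω : Ω}
    (hT : ρ ω ≤ T) :
    X.realizedPayoff v c ρ ω = X.realizedPayoff v c (fun ω => min (ρ ω) (τ.time ω)) ω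
      - c * ((ρ ω : ℝ) - (min (ρ ω) (τ.time ω) : ℝ≥0)) := by
  -- A success by ρ ≤ T is a completion by the deadline, and the schedule waits for every such
  -- completion.
  have hiff : X.completion₂ ω ≤ ρ ω ↔ X.completion₂ ω ≤ min (ρ ω) (τ.time ω) := by
    rw [le_min_iff]
    refine ⟨fun h => ⟨h, ?_⟩, And.left⟩
    have h1 := hwait ω
    rwa [min_eq_left (h.trans hT)] at h1
  simp only [Project.realizedPayoff, Project.state_eq_two_iff, ← hiff]
  ring

theorem realizedPayoff_le_min_time {τ : InvestmentSchedule X T}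
    (hwait : ∀ ω, min (X.completion₂ ω) T ≤ τ.time ω) (v : ℝ) {c : ℝ} (hc : 0 < c) {ρ : Ω → ℝ≥0}
    {ω : Ω} (hT : ρ ω ≤ T) :
    X.realizedPayoff v c ρ ω ≤ X.realizedPayoff v c (fun ω => min (ρ ω) (τ.time ω)) ω := by
  rw [realizedPayoff_min_time hwait v c hT]
  have h : ((min (ρ ω) (τ.time ω) : ℝ≥0) : ℝ) ≤ ρ ω := NNReal.coe_le_coe.2 (min_le_left _ _)
  nlinarith

/-- If the principal does not want to stop earlier at any deterministic date, then he follows the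
recommendations of a schedule that waits for the second stage. -/
theorem setIntegral_realizedPayoff_le [IsProbabilityMeasure P] {τ : InvestmentSchedule X T}
    (hwait : ∀ ω, min (X.completion₂ ω) T ≤ τ.time ω) {v c : ℝ} (hc : 0 < c)
    (hIR : ∀ r ≤ T, X.principalPayoff v c (fun ω => min r (τ.time ω))
      ≤ X.principalPayoff v c τ.time)
    {ρ : Ω → ℝ≥0} (hρ : IsStrategy τ.mechanism T ρ) {t : ℝ≥0} (htT : t ≤ T) (ht : ∀ ω, t ≤ ρ ω) :
    ∫ ω in {ω | t < τ.time ω}, X.realizedPayoff v c ρ ω ∂P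
      ≤ ∫ ω in {ω | t < τ.time ω}, X.realizedPayoff v c τ.time ω ∂P := by
  obtain ⟨r, htr, hrT, hr⟩ := τ.exists_min_eq_min hρ htT ht
  have hA : MeasurableSet {ω | t < τ.time ω} := measurableSet_lt measurable_const τ.measurable_time
  have hmin : Measurable fun ω => min r (τ.time ω) := measurable_const.min τ.measurable_time
  have hminT : ∀ ω, min r (τ.time ω) ≤ T := fun ω => (min_le_left _ _).trans hrT
  have hi1 := X.integrable_realizedPayoff (P := P) v c hρ.measurable hρ.le_deadline
  have hi2 := X.integrable_realizedPayoff (P := P) v c hmin hminT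
  have hi3 := X.integrable_realizedPayoff (P := P) v c τ.measurable_time τ.le_deadline
  have hfun : (fun ω => min (ρ ω) (τ.time ω)) = fun ω => min r (τ.time ω) := funext hr
  calc ∫ ω in {ω | t < τ.time ω}, X.realizedPayoff v c ρ ω ∂P
      ≤ ∫ ω in {ω | t < τ.time ω}, X.realizedPayoff v c (fun ω => min r (τ.time ω)) ω ∂P := by
        refine integral_mono hi1.integrableOn hi2.integrableOn fun ω => ?_
        rw [← hfun]
        exact realizedPayoff_le_min_time hwait v hc (hρ.le_deadline ω)
    _ ≤ ∫ ω in {ω | t < τ.time ω}, X.realizedPayoff v c τ.time ω ∂P := by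
        have h := hIR r hrT
        rw [← X.integral_realizedPayoff_eq v c hmin hminT,
          ← X.integral_realizedPayoff_eq v c τ.measurable_time τ.le_deadline,
          ← integral_add_compl hA hi2, ← integral_add_compl hA hi3] at h
        -- Off the reached event τ ≤ t ≤ r, so truncating at `r` has no effect and the unconditional
        -- inequality localizes to the reached event.
        have heq : ∫ ω in {ω | t < τ.time ω}ᶜ,
            X.realizedPayoff v c (fun ω => min r (τ.time ω)) ω ∂P
              = ∫ ω in {ω | t < τ.time ω}ᶜ, X.realizedPayoff v c τ.time ω ∂P := by
          refine setIntegral_congr_fun hA.compl fun ω hω => ?_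
          have h1 : τ.time ω ≤ t := not_lt.1 hω
          simp [Project.realizedPayoff, min_eq_right (h1.trans htr)]
        linarith

theorem isBestReply_time [IsProbabilityMeasure P] {τ : InvestmentSchedule X T}
    (hwait : ∀ ω, min (X.completion₂ ω) T ≤ τ.time ω) {v c : ℝ} (hc : 0 < c)
    (hIR : ∀ r ≤ T, X.principalPayoff v c (fun ω => min r (τ.time ω))
      ≤ X.principalPayoff v c τ.time) :
    IsBestReply τ.mechanism v c T τ.time := by
  refine ⟨⟨τ.le_deadline, fun t => ?_⟩, fun ρ hρ => ?_⟩
  · have h := (τ.measurableSet_reached t).compl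
    convert! h using 1
    ext ω
    simp only [Set.mem_ofPred_eq, Set.mem_compl_iff, WithTop.coe_le_coe, not_lt]
  · obtain ⟨r, -, hrT, hr⟩ := τ.exists_min_eq_min hρ bot_le fun _ => bot_le
    have hmin : Measurable fun ω => min r (τ.time ω) := measurable_const.min τ.measurable_time
    have hminT : ∀ ω, min r (τ.time ω) ≤ T := fun ω => (min_le_left _ _).trans hrT
    refine le_trans ?_ (hIR r hrT)
    rw [← X.integral_realizedPayoff_eq v c hmin hminT,
      ← X.integral_realizedPayoff_eq v c hρ.measurable hρ.le_deadline]
    refine integral_mono (X.integrable_realizedPayoff v c hρ.measurable hρ.le_deadline)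
      (X.integrable_realizedPayoff v c hmin hminT) fun ω => ?_
    rw [← funext hr]
    exact realizedPayoff_le_min_time hwait v hc (hρ.le_deadline ω)

theorem isObedient_of_wait [IsProbabilityMeasure P] {τ : InvestmentSchedule X T}
    (hwait : ∀ ω, min (X.completion₂ ω) T ≤ τ.time ω) {v c : ℝ} (hc : 0 < c)
    (hIR : ∀ r ≤ T, X.principalPayoff v c (fun ω => min r (τ.time ω))
      ≤ X.principalPayoff v c τ.time) :
    τ.IsObedient v c := by
  have hi3 := X.integrable_realizedPayoff (P := P) v c τ.measurable_time τ.le_deadline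
  refine ⟨fun t ρ hρ ht => ?_, fun ρ hρ hle hne => ?_⟩
  · have hi1 := X.integrable_realizedPayoff (P := P) v c hρ.measurable hρ.le_deadline
    have hm := τ.mechanism.filtration.le t
    have hA := τ.measurableSet_reached t
    set f := P[X.realizedPayoff v c ρ | τ.mechanism.filtration t] with hf
    set g := P[X.realizedPayoff v c τ.time | τ.mechanism.filtration t] with hg
    -- The event of a profitable deviation is known at `t`, so it contains the atom {t < τ} or
    -- misses it. If it contains the atom, the integral comparison over the atom forces the atom to
    -- be null.
    have hB : MeasurableSet[τ.mechanism.filtration t] {ω | g ω < f ω} :=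
      stronglyMeasurable_condExp.measurableSet_lt stronglyMeasurable_condExp
    rcases τ.reached_subset_or_disjoint hB with hs | hs
    · have htT : t ≤ T ∨ P {ω | t < τ.time ω} = 0 := by
        rcases le_or_gt t T with h | h
        · exact Or.inl h
        · refine Or.inr ?_
          convert! measure_empty
          · ext ω
            simpa using (τ.le_deadline ω).trans h.le
          · infer_instance
      have hnull : P {ω | t < τ.time ω} = 0 := by
        rcases htT with htT | h
        swap
        · exact h
        have hint := setIntegral_realizedPayoff_le hwait hc hIR hρ htT ht
        rw [← setIntegral_condExp hm hi1 hA, ← setIntegral_condExp hm hi3 hA] at hint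
        have hfg : IntegrableOn (fun ω => f ω - g ω) {ω | t < τ.time ω} P :=
          (integrable_condExp.sub integrable_condExp).integrableOn
        by_contra hpos
        have h0 : 0 < ∫ ω in {ω | t < τ.time ω}, (f ω - g ω) ∂P := by
          rw [setIntegral_pos_iff_support_of_nonneg_ae _ hfg]
          · have hsupp : Function.support (fun ω => f ω - g ω) ∩ {ω | t < τ.time ω}
                = {ω | t < τ.time ω} := by
              refine Set.inter_eq_right.2 fun ω hω => ?_
              have : g ω < f ω := hs hω
              exact (sub_pos.2 this).ne'
            rw [hsupp]
            exact pos_iff_ne_zero.2 hpos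
          · refine (ae_restrict_iff' (hm _ hA)).2 (Filter.Eventually.of_forall fun ω hω => ?_)
            have : g ω < f ω := hs hω
            exact (sub_pos.2 this).le
        rw [integral_sub integrable_condExp.integrableOn integrable_condExp.integrableOn] at h0
        linarith
      filter_upwards [measure_eq_zero_iff_ae_notMem.1 hnull] with ω hω hω'
      exact absurd hω' hω
    · exact Filter.Eventually.of_forall fun ω hω => not_lt.1 (Set.disjoint_left.1 hs hω)
  · have hmeas := hρ.measurable
    have hgap : Integrable (fun ω => c * ((ρ ω : ℝ) - τ.time ω)) P :=
      ((Project.integrable_coe_of_le hmeas hρ.le_deadline).sub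
        (Project.integrable_coe_of_le τ.measurable_time τ.le_deadline)).const_mul c
    have hpos : 0 < ∫ ω, c * ((ρ ω : ℝ) - τ.time ω) ∂P := by
      rw [integral_pos_iff_support_of_nonneg _ hgap]
      · refine lt_of_lt_of_le (pos_iff_ne_zero.2 hne) (measure_mono fun ω hω => ?_)
        have : (τ.time ω : ℝ) < ρ ω := NNReal.coe_lt_coe.2 hω
        exact (mul_pos hc (sub_pos.2 this)).ne'
      · intro ω
        exact mul_nonneg hc.le (sub_nonneg.2 (NNReal.coe_le_coe.2 (hle ω)))
    have hval : ∀ ω, X.realizedPayoff v c ρ ω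
        = X.realizedPayoff v c τ.time ω - c * ((ρ ω : ℝ) - τ.time ω) := by
      intro ω
      rw [realizedPayoff_min_time hwait v c (hρ.le_deadline ω)]
      simp only [Project.realizedPayoff, min_eq_right (hle ω)]
    rw [← X.integral_realizedPayoff_eq v c hmeas hρ.le_deadline,
      ← X.integral_realizedPayoff_eq v c τ.measurable_time τ.le_deadline]
    simp_rw [hval]
    rw [integral_sub hi3 hgap]
    linarith

end InvestmentSchedule

namespace Project

theorem principalPayoff_min_delayedDisclosure_le [IsProbabilityMeasure P] (X : Project P lam)
    (hlam : 0 < lam) {v c : ℝ} {S T : ℝ≥0} (hST : S ≤ T)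
    (hdet : ∀ s ≤ T, deterministicPayoff lam v c s ≤ delayedPayoff lam v c S T)
    (hdelay : ∀ t ≤ T, S ≤ t → delayedPayoff lam v c S t ≤ delayedPayoff lam v c S T)
    {r : ℝ≥0} (hr : r ≤ T) :
    X.principalPayoff v c (fun ω => min r ((X.delayedDisclosure hST).time ω))
      ≤ X.principalPayoff v c (X.delayedDisclosure hST).time := by
  have hτ : X.principalPayoff v c (X.delayedDisclosure hST).time = delayedPayoff lam v c S T :=
    X.principalPayoff_max_min hlam v c hST
  rw [hτ]
  -- Stopping at r ≤ S is a deterministic date; stopping at r ≥ S is delayed disclosure with horizon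
  -- `r` in place of `T`.
  rcases le_total r S with h | h
  · have hfun : (fun ω => min r ((X.delayedDisclosure hST).time ω)) = fun _ => r :=
      funext fun ω => min_eq_left (h.trans (le_max_left _ _))
    rw [hfun, X.principalPayoff_const hlam]
    exact hdet r hr
  · have hfun : (fun ω => min r ((X.delayedDisclosure hST).time ω))
        = fun ω => max S (min (X.completion₂ ω) r) := by
      funext ω
      change min r (max S (min (X.completion₂ ω) T)) = _
      rw [min_max_distrib_left, min_eq_right h, min_left_comm, min_eq_left hr]
    rw [hfun, X.principalPayoff_max_min hlam v c h]
    exact hdelay r hr h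

end Project

end TwoStage

/-! ### The proposition -/

theorem proposition2 (lam v c : ℝ) (T : ℝ≥0) (hlam : 0 < lam) (hv : 0 < v) (hc : 0 < c)
    (hT : lam * T * (lam * T + 1) + 1 < Real.exp (lam * T))
    (hlow : TwoStage.kappaND T lam < c / (v * lam))
    (hhigh : c / (v * lam) ≤ TwoStage.kappaTilde T lam) :
    ∃ S : ℝ≥0, S < T ∧
      ∀ (Ω : Type*) [MeasurableSpace Ω] (P : Measure Ω) [IsProbabilityMeasure P]
        (X : TwoStage.Project P lam),
        ∃ τ : TwoStage.InvestmentSchedule X T,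
          -- the schedule, and the recommendations that it generates
          (∀ ω, τ.time ω = max S (min (X.completion₂ ω) T)) ∧
          (∀ ω, ∀ t < S, τ.recommendation t ω = 1) ∧
          (∀ ω t, S ≤ t → t < T → (τ.recommendation t ω = 0 ↔ X.state t ω = 2)) ∧
          -- the principal gets his no-information payoff
          X.principalPayoff v c τ.time = X.noInfoValue v c T ∧
          -- his constraint binds at the optimal stopping date of the no-information benchmark
          (∀ s ≤ T, X.principalPayoff v c (fun _ => s) = X.noInfoValue v c T →
            X.continuationValue v c τ.time s = 0) ∧
          -- the schedule solves the agent's problem and is obedient at every date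
          τ.SolvesAgentProblem v c ∧
          τ.IsObedient v c ∧
          -- the mechanism is optimal for the agent among all information policies
          TwoStage.IsBestReply τ.mechanism v c T τ.time ∧
          (∀ (M : Type*) [MeasurableSpace M] (σ : TwoStage.InformationPolicy X M) (ρ : Ω → ℝ≥0),
            TwoStage.IsBestReply σ v c T ρ → X.agentPayoff c ρ ≤ X.agentPayoff c τ.time) := by
  have hTpos : 0 < T := by
    refine pos_iff_ne_zero.2 fun h => ?_
    simp [h] at hT
  obtain ⟨S, hST, ⟨m, hmT, hm⟩, hdet, hlast, hdelay⟩ :=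
    TwoStage.exists_disclosure_date hlam hv hc hTpos hlow hhigh
  refine ⟨S, hST, fun Ω _ P _ X => ?_⟩
  have htime : ∀ ω, (X.delayedDisclosure hST.le).time ω = max S (min (X.completion₂ ω) T) :=
    fun _ => rfl
  have hwait : ∀ ω, min (X.completion₂ ω) T ≤ (X.delayedDisclosure hST.le).time ω :=
    fun _ => le_max_right _ _
  have hIR : ∀ r ≤ T, X.principalPayoff v c (fun ω => min r ((X.delayedDisclosure hST.le).time ω))
      ≤ X.principalPayoff v c (X.delayedDisclosure hST.le).time := fun r hr =>
    X.principalPayoff_min_delayedDisclosure_le hlam hST.le hdet hdelay hr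
  have hvalue : X.principalPayoff v c (X.delayedDisclosure hST.le).time
      = TwoStage.delayedPayoff lam v c S T := X.principalPayoff_max_min hlam v c hST.le
  have hnoInfo : X.noInfoValue v c T = TwoStage.delayedPayoff lam v c S T := by
    refine IsGreatest.csSup_eq ⟨⟨m, hmT, ?_⟩, ?_⟩
    · simp only
      rw [X.principalPayoff_const hlam, hm]
    · rintro _ ⟨s, hs, rfl⟩
      simp only
      rw [X.principalPayoff_const hlam]
      exact hdet s hs
  -- The schedule completes the project whenever completion by `T` is possible, so the agent
  -- receives the maximal surplus less the principal's payoff.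
  have hagent : X.agentPayoff c (X.delayedDisclosure hST.le).time
      = TwoStage.completionProb lam T * v - TwoStage.delayedPayoff lam v c S T := by
    have hset : {ω | X.state ((X.delayedDisclosure hST.le).time ω) ω = 2}
        = {ω | X.completion₂ ω ≤ T} := by
      ext ω
      simp only [htime, X.state_eq_two_iff, Set.mem_ofPred_eq, le_max_iff, le_min_iff, le_refl,
        true_and]
      exact ⟨fun h => h.elim (fun h => h.trans hST.le) id, Or.inr⟩
    rw [← hvalue]
    unfold TwoStage.Project.principalPayoff TwoStage.Project.agentPayoff
    rw [hset, X.measureReal_completion₂_le hlam]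
    ring
  -- One constraint suffices: not wanting to stop at the maximizer `m` of the deterministic payoff.
  have hbound : ∀ {ρ : Ω → ℝ≥0}, Measurable ρ → (∀ ω, ρ ω ≤ T) →
      X.principalPayoff v c (fun ω => min m (ρ ω)) ≤ X.principalPayoff v c ρ →
        X.agentPayoff c ρ ≤ X.agentPayoff c (X.delayedDisclosure hST.le).time := by
    intro ρ hρ hρT h
    have h1 := X.agentPayoff_le hlam hv hc hρ hρT hmT h
    rwa [X.principalPayoff_const hlam, hm, ← hagent] at h1
  refine ⟨X.delayedDisclosure hST.le, htime, fun ω t ht => ?_, fun ω t hSt htT => ?_,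
    hvalue.trans hnoInfo.symm, fun s hs hsv => ?_, ⟨fun t _ => ?_, fun τ' hτ' => ?_⟩,
    TwoStage.InvestmentSchedule.isObedient_of_wait hwait hc hIR,
    TwoStage.InvestmentSchedule.isBestReply_time hwait hc hIR, fun M _ σ ρ hρ => ?_⟩
  · exact if_pos (ht.trans_le (le_max_left _ _))
  · simp [TwoStage.InvestmentSchedule.recommendation, htime, X.state_eq_two_iff, hSt.not_gt, htT]
  · rw [X.principalPayoff_const hlam, hnoInfo] at hsv
    have hsS := hlast s hs hsv
    have hfun : (fun ω => min s ((X.delayedDisclosure hST.le).time ω)) = fun _ => s :=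
      funext fun ω => min_eq_left (hsS.trans (le_max_left _ _))
    rw [X.continuationValue_eq v c (X.delayedDisclosure hST.le).measurable_time
      (X.delayedDisclosure hST.le).le_deadline, hfun, X.principalPayoff_const hlam, hsv, hvalue,
      sub_self, mul_zero]
  · rw [X.continuationValue_eq v c (X.delayedDisclosure hST.le).measurable_time
      (X.delayedDisclosure hST.le).le_deadline]
    refine mul_nonneg (inv_nonneg.2 measureReal_nonneg) (sub_nonneg.2 ?_)
    -- Dates after `T` are never reached: truncating there leaves the schedule unchanged.
    rcases le_total t T with h | h
    · exact hIR t h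
    · have hfun : (fun ω => min t ((X.delayedDisclosure hST.le).time ω))
          = (X.delayedDisclosure hST.le).time :=
        funext fun ω => min_eq_right (((X.delayedDisclosure hST.le).le_deadline ω).trans h)
      rw [hfun]
  · refine hbound τ'.measurable_time τ'.le_deadline ?_
    -- If `m` is almost surely not reached, the constraint there is void, but truncating at `m` then
    -- changes `τ'` only on a null set.
    by_cases h0 : P {ω | m < τ'.time ω} = 0
    · rw [← X.integral_realizedPayoff_eq v c (measurable_const.min τ'.measurable_time)
          fun ω => (min_le_left m _).trans hmT,
        ← X.integral_realizedPayoff_eq v c τ'.measurable_time τ'.le_deadline]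
      refine (integral_congr_ae ?_).le
      filter_upwards [measure_eq_zero_iff_ae_notMem.1 h0] with ω hω
      simp [TwoStage.Project.realizedPayoff, min_eq_right (not_lt.1 hω)]
    · have h1 := hτ' m h0
      rw [X.continuationValue_eq v c τ'.measurable_time τ'.le_deadline] at h1
      have h2 : 0 < P.real {ω | m < τ'.time ω} :=
        ENNReal.toReal_pos h0 (measure_ne_top _ _)
      exact sub_nonneg.1 (nonneg_of_mul_nonneg_right h1 (inv_pos.2 h2))
  · have hmeas := hρ.isStrategy.measurable
    -- The date `m` is a strategy under every policy, so a best reply secures the no-information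
    -- payoff.
    have h1 := hρ.optimal _ (TwoStage.isStrategy_const σ hmT)
    rw [X.principalPayoff_const hlam, hm] at h1
    have h2 : P.real {ω | X.state (ρ ω) ω = 2} ≤ TwoStage.completionProb lam T := by
      rw [← X.measureReal_completion₂_le hlam]
      refine measureReal_mono fun ω hω => ?_
      exact ((X.state_eq_two_iff _ _).1 hω).trans (hρ.isStrategy.le_deadline ω)
    rw [hagent]
    unfold TwoStage.Project.principalPayoff at h1
    unfold TwoStage.Project.agentPayoff
    nlinarith [mul_le_mul_of_nonneg_right h2 hv.le]
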